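/- Let $\Gamma=(Q,A,E,(\delta_e)_{e\in E})$ be a multi-environment Markov decision process: $Q$ (states), $A$ (actions) and $E$ (environments) are non-empty finite sets, and for each $e\in E$ the map $\delta_e\colon Q\times A\to\mathcal D(Q)$ assigns to each state-action pair a probability distribution on $Q$, so that $\Gamma[e]=(Q,A,\delta_e)$ is a Markov decision process. A strategy is a function $\sigma$ from finite runs, i.e. elements of $Q\cdot(A\cdot Q)^*$, to the set $\mathcal D(A)$ of probability distributions on $A$. For $q\in Q$ and $e \in E$, let $\mathbb P_q^\sigma[\Gamma[e],\cdot]$ be the probability measure on the Borel subsets of the space $Q^\omega$ of infinite paths obtained by projection (forgetting the actions) from the unique probability measure on infinite runs for which the set of infinite runs with prefix $q_0(a_1,q_1)\cdots(a_n,q_n)$ has measure $\prod_{i=1}^n \sigma(q_0(a_1,q_1)\cdots(a_{i-1},q_{i-1}))(a_i)\cdot\delta_e(q_{i-1},a_i)(q_i)$ if $q_0=q$, and measure $0$ otherwise. For a Borel set $W\subseteq Q^\omega$ and a prior belief $b\in\mathcal D(E)$ (a probability distribution on $E$), define the universal and prior values $$\mathrm{val}^{\mathrm{uni}}_q(\Gamma,W)=\sup_\sigma\min_{e\in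 E}\mathbb P_q^\sigma[\Gamma[e],W],\qquad \mathrm{val}^{\mathrm{pr}}_q(\Gamma,b,W)=\sup_\sigma\sum_{e\in E}b(e)\,\mathbb P_q^\sigma[\Gamma[e],W].$$ Theorem. For every such $\Gamma$, every state $q\in Q$ and every Borel objective $W\subseteq Q^\omega$, $$\mathrm{val}^{\mathrm{uni}}_q(\Gamma,W)=\inf_{b\in\mathcal D(E)}\mathrm{val}^{\mathrm{pr}}_q(\Gamma,b,W).$$ In particular, this holds for every parity objective, i.e. every set $W$ of the form $\{\rho\in Q^\omega\mid \max\{n\in\mathbb{N}\mid f(\rho_j)=n\text{ for infinitely many }j\}\text{ is even}\}$ with $f\colon Q\to\mathbb N$. -/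

import Mathlib

open MeasureTheory ProbabilityTheory
open scoped ENNReal

namespace MultiEnv

/-- A Markov decision process on the states `Q` and the actions `A`: its transition function. -/
structure MDP (Q A : Type*) where
  δ : Q → A → PMF Q

/-- A multi-environment Markov decision process: one MDP `Γ.env e` on the same states and actions
for each environment `e`. -/
structure MEMDP (Q A E : Type*) where
  env : E → MDP Q A

/-- Finite runs `q₀ · (a₁, q₁) ⋯ (aₙ, qₙ)`, that is, elements of `Q · (A · Q)^*`. -/
abbrev FiniteRun (Q A : Type*) := Q × List (A × Q)

/-- The last state of a finite run. -/
def FiniteRun.head {Q A : Type*} (ρ : FiniteRun Q A) : Q :=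
  (ρ.2.map Prod.snd).getLastD ρ.1

/-- (Behavioral, history-dependent, randomized) strategies. -/
abbrev Strategy (Q A : Type*) := FiniteRun Q A → PMF A

/-- The distribution of the next pair (action, successor state) after the finite run `ρ`:
`(a, t)` has probability `σ(ρ)(a) · δ(head ρ, a)(t)`. -/
noncomputable def MDP.step {Q A : Type*} (G : MDP Q A) (σ : Strategy Q A) (ρ : FiniteRun Q A) :
    PMF (A × Q) :=
  (σ ρ).bind fun a => (G.δ ρ.head a).map fun t => (a, t)

/-- The finite run from `q` whose successive pairs (action, state) are `h 0, …, h n`. -/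
def runOfSteps {Q A : Type*} (q : Q) (n : ℕ) (h : (i : Finset.Iic n) → A × Q) : FiniteRun Q A :=
  (q, List.ofFn fun i : Fin (n + 1) => h ⟨i, Finset.mem_Iic.2 (Nat.lt_succ_iff.1 i.2)⟩)

/-- The infinite path (sequence of states) of an infinite run from `q`; the infinite run
`q · (a₁, q₁) · (a₂, q₂) ⋯` is represented by the sequence `(a₁, q₁), (a₂, q₂), …`. -/
def statePath {Q A : Type*} (q : Q) (ω : ℕ → A × Q) : ℕ → Q
  | 0 => q
  | n + 1 => (ω n).2

theorem measurable_statePath {Q A : Type*} [MeasurableSpace Q] [MeasurableSpace A] (q : Q) :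
    Measurable (statePath q : (ℕ → A × Q) → ℕ → Q) := by
  refine measurable_pi_iff.2 fun n => ?_
  cases n with
  | zero => exact measurable_const
  | succ n => exact measurable_snd.comp (measurable_pi_apply n)

section Measure

variable {Q A E : Type*} [Finite Q] [Finite A]
  [MeasurableSpace Q] [DiscreteMeasurableSpace Q] [MeasurableSpace A] [DiscreteMeasurableSpace A]

/-- The kernel that gives the law of step `n + 1` as a function of the steps `0, …, n`. -/
noncomputable def MDP.stepKernel (G : MDP Q A) (σ : Strategy Q A) (q : Q) (n : ℕ) :
    Kernel ((i : Finset.Iic n) → A × Q) (A × Q) where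
  toFun h := (G.step σ (runOfSteps q n h)).toMeasure
  measurable' := .of_discrete

instance (G : MDP Q A) (σ : Strategy Q A) (q : Q) (n : ℕ) :
    IsMarkovKernel (G.stepKernel σ q n) :=
  ⟨fun h => PMF.toMeasure.isProbabilityMeasure (G.step σ (runOfSteps q n h))⟩

/-- The probability measure on infinite runs from `q` that the strategy `σ` induces in `G`,
by the Ionescu-Tulcea theorem. -/
noncomputable def MDP.runMeasure (G : MDP Q A) (σ : Strategy Q A) (q : Q) :
    Measure (ℕ → A × Q) :=
  Kernel.trajMeasure (X := fun _ => A × Q) (G.step σ (q, [])).toMeasure (G.stepKernel σ q)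

/-- The probability measure on infinite paths that the strategy `σ` induces in `G` from `q`: the
projection of the measure on infinite runs. -/
noncomputable def MDP.pathMeasure (G : MDP Q A) (σ : Strategy Q A) (q : Q) : Measure (ℕ → Q) :=
  (G.runMeasure σ q).map (statePath q)

/-- The universal value of a strategy: the least probability of `W` over all environments. -/
noncomputable def MEMDP.uniValueOf (Γ : MEMDP Q A E) (q : Q) (σ : Strategy Q A)
    (W : Set (ℕ → Q)) : ℝ≥0∞ :=
  ⨅ e, (Γ.env e).pathMeasure σ q W

/-- The universal value. -/
noncomputable def MEMDP.uniValue (Γ : MEMDP Q A E) (q : Q) (W : Set (ℕ → Q)) : ℝ≥0∞ :=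
  ⨆ σ : Strategy Q A, Γ.uniValueOf q σ W

/-- The prior value of a strategy, for the prior belief `b` on the environments. -/
noncomputable def MEMDP.priorValueOf [Fintype E] (Γ : MEMDP Q A E) (q : Q) (b : PMF E)
    (σ : Strategy Q A) (W : Set (ℕ → Q)) : ℝ≥0∞ :=
  ∑ e, b e * (Γ.env e).pathMeasure σ q W

/-- The prior value. -/
noncomputable def MEMDP.priorValue [Fintype E] (Γ : MEMDP Q A E) (q : Q) (b : PMF E)
    (W : Set (ℕ → Q)) : ℝ≥0∞ :=
  ⨆ σ : Strategy Q A, Γ.priorValueOf q b σ W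

end Measure

/-- The parity objective of a labelling: the greatest label seen infinitely often is even. -/
def parityObjective {Q : Type*} (f : Q → ℕ) : Set (ℕ → Q) :=
  {ρ | ∃ m, IsGreatest {n | ∀ i, ∃ j ≥ i, f (ρ j) = n} m ∧ Even m}

end MultiEnv

/-! The inequality `≤` holds because a minimum is at most any average. For `≥`, each strategy gives
a vector of winning probabilities indexed by environments, and the set of these vectors is convex.
Let `c` be the universal value. No vector lies in the open orthant of points with all coordinates
above `c`, so a hyperplane separates the two convex sets; its normal, once normalized, is a belief
whose prior value is at most `c` (`iSup_iInf_eq_iInf_iSup_of_convex`).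

Convexity is the Kuhn-type fact `runMeasure_mixStrategy`: tossing a coin between two strategies at
the start is equivalent to one behavioral strategy. The posterior of the coin depends only on the
actions chosen, because transition probabilities cancel, so the same strategy works in every
environment. -/

/-! ### Minimax by separation of convex sets -/

/-- Minimax over the simplex for a family of payoff vectors closed under convex combinations. -/
theorem iSup_iInf_eq_iInf_iSup_of_convex {E ι : Type*} [Fintype E] [Nonempty E] [Nonempty ι]
    (v : ι → E → ℝ≥0∞) (hv : ∀ i e, v i e ≤ 1)
    (hconv : ∀ i j (a b : ℝ≥0∞), a + b = 1 → ∃ k, ∀ e, v k e = a * v i e + b * v j e) :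
    ⨆ i, ⨅ e, v i e = ⨅ b : PMF E, ⨆ i, ∑ e, b e * v i e := by
  classical
  apply le_antisymm
  · refine le_iInf fun b => iSup_mono fun i => ?_
    calc ⨅ e, v i e = ∑ e, b e * ⨅ e, v i e := by
          rw [← Finset.sum_mul, ← tsum_fintype (L := .unconditional _), b.tsum_coe, one_mul]
      _ ≤ _ := Finset.sum_le_sum fun e _ => by gcongr; exact iInf_le _ e
  set c := ⨆ i, ⨅ e, v i e with hc
  have hc1 : c ≤ 1 := iSup_le fun i => (iInf_le _ (Classical.arbitrary E)).trans (hv i _)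
  have hct : c ≠ ∞ := ne_top_of_le_ne_top ENNReal.one_ne_top hc1
  have hvt : ∀ i e, v i e ≠ ∞ := fun i e => ne_top_of_le_ne_top ENNReal.one_ne_top (hv i e)
  let w : ι → E → ℝ := fun i e => (v i e).toReal
  have hK : Convex ℝ (Set.range w) := by
    rintro _ ⟨i, rfl⟩ _ ⟨j, rfl⟩ a b ha hb hab
    obtain ⟨k, hk⟩ := hconv i j (ENNReal.ofReal a) (ENNReal.ofReal b)
      (by rw [← ENNReal.ofReal_add ha hb, hab, ENNReal.ofReal_one])
    refine ⟨k, funext fun e => ?_⟩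
    simp only [w, hk, Pi.add_apply, Pi.smul_apply, smul_eq_mul]
    rw [ENNReal.toReal_add (by finiteness [hvt i e]) (by finiteness [hvt j e]),
      ENNReal.toReal_mul, ENNReal.toReal_mul,
      ENNReal.toReal_ofReal ha, ENNReal.toReal_ofReal hb]
  let U : Set (E → ℝ) := Set.univ.pi fun _ => Set.Ioi c.toReal
  have hU : ∀ u : E → ℝ, u ∈ U ↔ ∀ e, c.toReal < u e := by simp [U]
  obtain ⟨f, s, hfU, hfK⟩ := geometric_hahn_banach_open (s := U) (t := Set.range w)
    (convex_pi fun _ _ => convex_Ioi _)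
    (isOpen_set_pi Set.finite_univ fun _ _ => isOpen_Ioi) hK <| by
      rw [Set.disjoint_left]
      rintro _ hu ⟨i, rfl⟩
      rw [hU] at hu
      -- A coordinate attaining the minimum of `v i` is at most `c`, so `w i` is outside `U`.
      obtain ⟨e, he⟩ := exists_eq_ciInf_of_finite (f := v i)
      have h1 : v i e ≤ c := he.le.trans (le_iSup (fun i => ⨅ e, v i e) i)
      exact absurd (hu e) (not_lt.2 (ENNReal.toReal_mono hct h1))
  -- `f` lies below `s` on the upward-closed set `U`, so its coefficients are nonpositive; the sign
  -- is flipped to get weights.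
  let g : E → ℝ := fun e => - f (Pi.single e 1)
  have hf : ∀ u : E → ℝ, f u = - ∑ e, u e * g e := by
    intro u
    conv_lhs => rw [pi_eq_sum_univ' u]
    simp [g, map_sum, Finset.sum_neg_distrib]
  simp only [hf] at hfU hfK
  obtain ⟨i₀⟩ := ‹Nonempty ι›
  have hcU : ∀ ε > 0, -s < (c.toReal + ε) * ∑ e, g e := by
    intro ε hε
    have := hfU (fun _ => c.toReal + ε) ((hU _).2 fun _ => by linarith)
    rw [← Finset.mul_sum] at this
    linarith
  have hg : ∀ e, 0 ≤ g e := by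
    intro e
    by_contra! hlt
    have key : ∀ t : ℝ, 0 ≤ t → -s < (c.toReal + 1) * ∑ e, g e + t * g e := by
      intro t ht
      have := hfU (fun e' => c.toReal + 1 + if e' = e then t else 0)
        ((hU _).2 fun e' => by split_ifs <;> linarith)
      simp only [add_mul _ (ite _ _ _), Finset.sum_add_distrib, ite_mul, zero_mul,
        Finset.sum_ite_eq', Finset.mem_univ, if_true, ← Finset.mul_sum] at this
      linarith
    -- If `g e < 0`, raising coordinate `e` stays in `U`; this `t` makes the right-hand side of
    -- `key` exactly `-s`.
    have h0 := key 0 le_rfl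
    have h1 := key (((c.toReal + 1) * ∑ e, g e + s) / (- g e))
      (div_nonneg (by linarith) (by linarith))
    rw [div_mul_eq_mul_div, div_neg, mul_div_cancel_right₀ _ hlt.ne] at h1
    linarith
  have hG : 0 < ∑ e, g e := by
    -- If all weights vanished, `f` would be zero, giving both `0 < s` and `s ≤ 0`.
    refine (Finset.sum_nonneg fun e _ => hg e).lt_of_ne' fun h0 => ?_
    have h1 := hcU 1 one_pos
    have h2 := hfK _ ⟨i₀, rfl⟩
    have h3 : ∑ e, w i₀ e * g e = 0 := Finset.sum_eq_zero fun e _ => by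
      rw [(Finset.sum_eq_zero_iff_of_nonneg fun e _ => hg e).1 h0 e (Finset.mem_univ e), mul_zero]
    rw [h0] at h1
    linarith
  have hcs : -s ≤ c.toReal * ∑ e, g e := by
    refine le_of_forall_pos_lt_add fun ε hε => ?_
    have := hcU (ε / ∑ e, g e) (by positivity)
    rwa [add_mul, div_mul_cancel₀ _ hG.ne'] at this
  let b : PMF E := PMF.ofFintype (fun e => ENNReal.ofReal (g e / ∑ e, g e)) <| by
    rw [← ENNReal.ofReal_sum_of_nonneg fun e _ => div_nonneg (hg e) hG.le, ← Finset.sum_div,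
      div_self hG.ne', ENNReal.ofReal_one]
  refine (iInf_le _ b).trans (iSup_le fun i => ?_)
  have h2 := hfK _ ⟨i, rfl⟩
  calc ∑ e, b e * v i e = ∑ e, ENNReal.ofReal (g e / (∑ e, g e) * w i e) := by
        refine Finset.sum_congr rfl fun e _ => ?_
        rw [ENNReal.ofReal_mul (div_nonneg (hg e) hG.le), ENNReal.ofReal_toReal (hvt i e)]
        rfl
    _ = ENNReal.ofReal ((∑ e, w i e * g e) / ∑ e, g e) := by
        rw [← ENNReal.ofReal_sum_of_nonneg fun e _ =>
          mul_nonneg (div_nonneg (hg e) hG.le) ENNReal.toReal_nonneg, Finset.sum_div]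
        congr 1
        exact Finset.sum_congr rfl fun e _ => by ring
    _ ≤ c := by
        refine ENNReal.ofReal_le_of_le_toReal ?_
        rw [div_le_iff₀ hG]
        linarith

/-! ### Products of step weights along a finite run -/

section PrefixWeight

variable {X : Type*}

/-- The product of the weights `p (pre ++ [x₁, …, xᵢ₋₁]) xᵢ` along the list `[x₁, …, xₙ]`. -/
noncomputable def prefixWeight (p : List X → X → ℝ≥0∞) : List X → List X → ℝ≥0∞
  | _, [] => 1
  | pre, x :: l => p pre x * prefixWeight p (pre ++ [x]) l

/-- The recursion peels off the first step, whereas runs grow at the end. -/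
theorem prefixWeight_append_singleton (p : List X → X → ℝ≥0∞) (pre l : List X) (x : X) :
    prefixWeight p pre (l ++ [x]) = prefixWeight p pre l * p (pre ++ l) x := by
  induction l generalizing pre with
  | nil => simp [prefixWeight]
  | cons y l ih => simp [prefixWeight, ih, mul_assoc]

theorem prefixWeight_mul (p p' : List X → X → ℝ≥0∞) (pre l : List X) :
    prefixWeight (fun l x => p l x * p' l x) pre l =
      prefixWeight p pre l * prefixWeight p' pre l := by
  induction l generalizing pre with
  | nil => simp [prefixWeight]
  | cons y l ih => simp only [prefixWeight, ih]; ring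

theorem prefixWeight_ne_top {p : List X → X → ℝ≥0∞} (hp : ∀ l x, p l x ≠ ∞) (pre l : List X) :
    prefixWeight p pre l ≠ ∞ := by
  induction l generalizing pre with
  | nil => simp [prefixWeight]
  | cons y l ih => exact ENNReal.mul_ne_top (hp _ _) (ih _)

end PrefixWeight

/-! ### Cylinders and their probabilities -/

section Cylinder

variable {X : Type*} [Finite X] [MeasurableSpace X] [DiscreteMeasurableSpace X]

/-- Finite measures on sequences that agree on the cylinders of finite prefixes are equal. -/
theorem measure_ext_of_cylinder {μ ν : Measure (ℕ → X)} [IsFiniteMeasure ν]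
    (h : ∀ (n : ℕ) (x : ℕ → X), μ {ω | ∀ i ≤ n, ω i = x i} = ν {ω | ∀ i ≤ n, ω i = x i}) :
    μ = ν := by
  have hP : IsProjectiveMeasureFamily (fun I : Finset ℕ => ν.map I.restrict) := by
    intro I J hJ
    rw [Measure.map_map (by fun_prop) (by fun_prop)]
    rfl
  refine IsProjectiveLimit.unique (P := fun I : Finset ℕ => ν.map I.restrict) ?_ fun I => rfl
  refine (isProjectiveLimit_nat_iff hP μ).2 fun n => ?_
  refine Measure.ext_of_singleton fun y => ?_
  -- Truncating the index by `min i n` extends `y` to a full sequence; the values past `n` are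
  -- irrelevant.
  have hpre : (Preorder.frestrictLe (π := fun _ => X) n) ⁻¹' {y} =
      {ω | ∀ i ≤ n, ω i = (fun i => y ⟨min i n, by simp⟩) i} := by
    ext ω
    simp only [Set.mem_preimage, Set.mem_singleton_iff, Set.mem_ofPred_eq, funext_iff,
      Subtype.forall, Finset.mem_Iic, Preorder.frestrictLe_apply]
    refine forall₂_congr fun i hi => ?_
    simp only [min_eq_left hi]
  change μ.map (Preorder.frestrictLe n) {y} = ν.map (Preorder.frestrictLe n) {y}
  rw [Measure.map_apply (by fun_prop) (measurableSet_singleton y),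
    Measure.map_apply (by fun_prop) (measurableSet_singleton y), hpre, h]

end Cylinder

theorem step_apply {Q A : Type*} (G : MultiEnv.MDP Q A) (σ : MultiEnv.Strategy Q A)
    (ρ : MultiEnv.FiniteRun Q A) (x : A × Q) :
    G.step σ ρ x = σ ρ x.1 * G.δ ρ.head x.1 x.2 := by
  classical
  obtain ⟨a, t⟩ := x
  rw [MultiEnv.MDP.step, PMF.bind_apply, tsum_eq_single a]
  · rw [PMF.map_apply, tsum_eq_single t]
    · simp
    · intro t' ht'
      simp [ht'.symm]
  · intro a' ha'
    rw [PMF.map_apply]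
    simp [ha'.symm]

section Runs

variable {Q A : Type*} [Finite Q] [Finite A]
  [MeasurableSpace Q] [DiscreteMeasurableSpace Q] [MeasurableSpace A] [DiscreteMeasurableSpace A]

instance (G : MultiEnv.MDP Q A) (σ : MultiEnv.Strategy Q A) (q : Q) :
    IsProbabilityMeasure (G.runMeasure σ q) := by
  have : IsProbabilityMeasure (G.step σ (q, [])).toMeasure :=
    PMF.toMeasure.isProbabilityMeasure _
  unfold MultiEnv.MDP.runMeasure
  infer_instance

instance (G : MultiEnv.MDP Q A) (σ : MultiEnv.Strategy Q A) (q : Q) :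
    IsProbabilityMeasure (G.pathMeasure σ q) :=
  Measure.isProbabilityMeasure_map (MultiEnv.measurable_statePath q).aemeasurable

/-- The probability of the runs with a given finite prefix. -/
theorem runMeasure_cylinder (G : MultiEnv.MDP Q A) (σ : MultiEnv.Strategy Q A) (q : Q) (n : ℕ)
    (x : ℕ → A × Q) :
    G.runMeasure σ q {ω | ∀ i ≤ n, ω i = x i} =
      prefixWeight (fun l y => G.step σ (q, l) y) [] (List.ofFn fun i : Fin (n + 1) => x i) := by
  have hp : IsProbabilityMeasure (G.step σ (q, [])).toMeasure :=
    PMF.toMeasure.isProbabilityMeasure _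
  induction n with
  | zero =>
    have hmap : (G.runMeasure σ q).map (Preorder.frestrictLe 0) =
        (G.step σ (q, [])).toMeasure.map
          (MeasurableEquiv.piUnique (fun _ : Finset.Iic 0 => A × Q)).symm := by
      unfold MultiEnv.MDP.runMeasure Kernel.trajMeasure
      rw [Measure.map_comp _ _ (by fun_prop), Kernel.traj_map_frestrictLe,
        Kernel.partialTraj_self, Measure.id_comp]
    have := congrArg (fun μ => μ {fun _ => x 0}) hmap
    rw [Measure.map_apply (by fun_prop) (measurableSet_singleton _),
      Measure.map_apply (by fun_prop) (measurableSet_singleton _)] at this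
    have h1 : (Preorder.frestrictLe (π := fun _ => A × Q) 0) ⁻¹' {fun _ => x 0} =
        {ω | ∀ i ≤ 0, ω i = x i} := by
      ext ω
      simp [funext_iff]
    have h2 : (MeasurableEquiv.piUnique (fun _ : Finset.Iic 0 => A × Q)).symm ⁻¹' {fun _ => x 0} =
        {x 0} := by
      ext y
      exact ⟨fun h => congrFun h default, fun h => funext fun i => by
        obtain rfl : i = default := Subsingleton.elim _ _
        exact h⟩
    rw [h1, h2, PMF.toMeasure_apply_singleton _ _ (measurableSet_singleton _)] at this
    rw [this]
    simp [prefixWeight]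
  | succ n ih =>
    -- The joint law of the steps up to `n` and step `n + 1`, evaluated below at a single point,
    -- gives the one-step recursion.
    have key := Kernel.map_frestrictLe_trajMeasure_compProd_eq_map_trajMeasure
      (X := fun _ => A × Q) (μ₀ := (G.step σ (q, [])).toMeasure) (κ := G.stepKernel σ q) (a := n)
    change (G.runMeasure σ q).map (Preorder.frestrictLe n) ⊗ₘ G.stepKernel σ q n =
      (G.runMeasure σ q).map _ at key
    have := congrArg (fun μ => μ ({fun i : Finset.Iic n => x i} ×ˢ {x (n + 1)})) key
    rw [Measure.compProd_apply_prod (measurableSet_singleton _) (measurableSet_singleton _),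
      Measure.map_apply (by fun_prop)
        ((measurableSet_singleton _).prod (measurableSet_singleton _)),
      Measure.restrict_singleton, lintegral_smul_measure, lintegral_dirac,
      Measure.map_apply (by fun_prop) (measurableSet_singleton _)] at this
    have h1 : (Preorder.frestrictLe (π := fun _ => A × Q) n) ⁻¹' {fun i : Finset.Iic n => x i} =
        {ω | ∀ i ≤ n, ω i = x i} := by
      ext ω
      simp [funext_iff]
    have h2 : (fun ω : ℕ → A × Q => (Preorder.frestrictLe (π := fun _ => A × Q) n ω, ω (n + 1))) ⁻¹'
        ({fun i : Finset.Iic n => x i} ×ˢ {x (n + 1)}) = {ω | ∀ i ≤ n + 1, ω i = x i} := by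
      ext ω
      simp only [Set.mem_preimage, Set.mem_prod, Set.mem_singleton_iff, funext_iff,
        Subtype.forall, Finset.mem_Iic, Preorder.frestrictLe_apply, Set.mem_ofPred_eq]
      constructor
      · rintro ⟨h, h'⟩ i hi
        rcases Nat.le_succ_iff.1 hi with hi | rfl
        exacts [h i hi, h']
      · exact fun h => ⟨fun i hi => h i (by omega), h _ le_rfl⟩
    rw [h1, h2, ih] at this
    rw [← this, List.ofFn_succ_last (n := n + 1), prefixWeight_append_singleton, smul_eq_mul]
    congr 1
    change (G.step σ _).toMeasure {_} = _
    rw [PMF.toMeasure_apply_singleton _ _ (measurableSet_singleton _)]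
    rfl

end Runs

/-! ### Mixing two strategies -/

section Mix

variable {Q A : Type*}

/-- The probability that `σ` chooses the actions of the run `ρ`, given its states. -/
noncomputable def actionWeight (σ : MultiEnv.Strategy Q A) (ρ : MultiEnv.FiniteRun Q A) : ℝ≥0∞ :=
  prefixWeight (fun l y => σ (ρ.1, l) y.1) [] ρ.2

theorem actionWeight_append (σ : MultiEnv.Strategy Q A) (q : Q) (l : List (A × Q)) (y : A × Q) :
    actionWeight σ (q, l ++ [y]) = actionWeight σ (q, l) * σ (q, l) y.1 :=
  prefixWeight_append_singleton _ _ _ _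

theorem actionWeight_ne_top (σ : MultiEnv.Strategy Q A) (ρ : MultiEnv.FiniteRun Q A) :
    actionWeight σ ρ ≠ ∞ :=
  prefixWeight_ne_top (fun _ _ => PMF.apply_ne_top _ _) _ _

theorem tsum_mix (σ τ : MultiEnv.Strategy Q A) (a b : ℝ≥0∞) (ρ : MultiEnv.FiniteRun Q A) :
    ∑' x, (a * actionWeight σ ρ * σ ρ x + b * actionWeight τ ρ * τ ρ x) =
      a * actionWeight σ ρ + b * actionWeight τ ρ := by
  rw [ENNReal.tsum_add, ENNReal.tsum_mul_left, ENNReal.tsum_mul_left, PMF.tsum_coe, PMF.tsum_coe,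
    mul_one, mul_one]

open Classical in
/-- The behavioral strategy that is equivalent to playing `σ` with probability `a` and `τ` with
probability `b`: the two are weighted by their posterior probabilities. -/
noncomputable def mixStrategy (σ τ : MultiEnv.Strategy Q A) (a b : ℝ≥0∞) (hab : a + b = 1) :
    MultiEnv.Strategy Q A := fun ρ =>
  -- With total weight zero, the mixture never plays `ρ`, and the choice is arbitrary.
  if h : a * actionWeight σ ρ + b * actionWeight τ ρ = 0 then σ ρ
  else PMF.normalize (fun x => a * actionWeight σ ρ * σ ρ x + b * actionWeight τ ρ * τ ρ x)
    (by rwa [tsum_mix]) (by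
      rw [tsum_mix]
      have ha : a ≠ ∞ := ne_top_of_le_ne_top ENNReal.one_ne_top (hab ▸ le_self_add)
      have hb : b ≠ ∞ := ne_top_of_le_ne_top ENNReal.one_ne_top (hab ▸ le_add_self)
      exact ENNReal.add_ne_top.2 ⟨ENNReal.mul_ne_top ha (actionWeight_ne_top _ _),
        ENNReal.mul_ne_top hb (actionWeight_ne_top _ _)⟩)

/-- The product form avoids division: when the total weight is zero, both sides vanish. -/
theorem mul_mixStrategy_apply (σ τ : MultiEnv.Strategy Q A) (a b : ℝ≥0∞) (hab : a + b = 1)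
    (ρ : MultiEnv.FiniteRun Q A) (x : A) :
    (a * actionWeight σ ρ + b * actionWeight τ ρ) * mixStrategy σ τ a b hab ρ x =
      a * actionWeight σ ρ * σ ρ x + b * actionWeight τ ρ * τ ρ x := by
  have ha : a ≠ ∞ := ne_top_of_le_ne_top ENNReal.one_ne_top (hab ▸ le_self_add)
  have hb : b ≠ ∞ := ne_top_of_le_ne_top ENNReal.one_ne_top (hab ▸ le_add_self)
  unfold mixStrategy
  split_ifs with h
  · obtain ⟨h1, h2⟩ := add_eq_zero.1 h
    simp [h1, h2]
  · rw [PMF.normalize_apply, tsum_mix, mul_left_comm, ENNReal.mul_inv_cancel h, mul_one]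
    exact ENNReal.add_ne_top.2 ⟨ENNReal.mul_ne_top ha (actionWeight_ne_top _ _),
        ENNReal.mul_ne_top hb (actionWeight_ne_top _ _)⟩

/-- The product telescopes: the normalizing constant at each run is the weight accumulated so far.
The empty run is where `a + b = 1` enters. -/
theorem actionWeight_mixStrategy (σ τ : MultiEnv.Strategy Q A) (a b : ℝ≥0∞) (hab : a + b = 1)
    (q : Q) (l : List (A × Q)) :
    actionWeight (mixStrategy σ τ a b hab) (q, l) =
      a * actionWeight σ (q, l) + b * actionWeight τ (q, l) := by
  induction l using List.reverseRecOn with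
  | nil => simp [actionWeight, prefixWeight, hab]
  | append_singleton l y ih =>
    rw [actionWeight_append, ih, mul_mixStrategy_apply, actionWeight_append, actionWeight_append,
      mul_assoc, mul_assoc]

variable [Finite Q] [Finite A]
  [MeasurableSpace Q] [DiscreteMeasurableSpace Q] [MeasurableSpace A] [DiscreteMeasurableSpace A]

theorem runMeasure_mixStrategy (G : MultiEnv.MDP Q A) (σ τ : MultiEnv.Strategy Q A)
    (a b : ℝ≥0∞) (hab : a + b = 1) (q : Q) :
    a • G.runMeasure σ q + b • G.runMeasure τ q =
      G.runMeasure (mixStrategy σ τ a b hab) q := by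
  refine measure_ext_of_cylinder fun n x => ?_
  -- The transition factor does not depend on the strategy, so cylinder probabilities are linear in
  -- the action weight.
  have hw : ∀ (σ : MultiEnv.Strategy Q A) (l : List (A × Q)),
      prefixWeight (fun l y => G.step σ (q, l) y) [] l = actionWeight σ (q, l) *
        prefixWeight (fun l y => G.δ (MultiEnv.FiniteRun.head (q, l)) y.1 y.2) [] l := by
    intro σ l
    simp only [step_apply]
    exact prefixWeight_mul _ _ _ _
  simp only [Measure.add_apply, Measure.smul_apply, smul_eq_mul, runMeasure_cylinder, hw,
    actionWeight_mixStrategy]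
  ring

theorem pathMeasure_mixStrategy (G : MultiEnv.MDP Q A) (σ τ : MultiEnv.Strategy Q A)
    (a b : ℝ≥0∞) (hab : a + b = 1) (q : Q) :
    G.pathMeasure (mixStrategy σ τ a b hab) q =
      a • G.pathMeasure σ q + b • G.pathMeasure τ q := by
  have hm := MultiEnv.measurable_statePath (A := A) q
  unfold MultiEnv.MDP.pathMeasure
  rw [← runMeasure_mixStrategy, Measure.map_add _ _ hm, Measure.map_smul, Measure.map_smul]

end Mix

/-! ### Measurability of parity objectives, and the conclusion -/

theorem measurableSet_parityObjective {Q : Type*} [MeasurableSpace Q] [DiscreteMeasurableSpace Q]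
    (f : Q → ℕ) : MeasurableSet (MultiEnv.parityObjective f) := by
  have hS : ∀ n, MeasurableSet {ρ : ℕ → Q | ∀ i, ∃ j ≥ i, f (ρ j) = n} := by
    intro n
    have hj : ∀ j, MeasurableSet {ρ : ℕ → Q | f (ρ j) = n} := fun j =>
      (MeasurableSet.of_discrete (s := {x | f x = n})).preimage (measurable_pi_apply j)
    have : {ρ : ℕ → Q | ∀ i, ∃ j ≥ i, f (ρ j) = n} =
        ⋂ i, ⋃ j, ⋃ _ : j ≥ i, {ρ : ℕ → Q | f (ρ j) = n} := by
      ext; simp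
    rw [this]
    exact .iInter fun i => .iUnion fun j => .iUnion fun _ => hj j
  -- The greatest recurring label is `m` iff `m` recurs and no larger label does, a countable
  -- combination of measurable conditions.
  have : MultiEnv.parityObjective f = ⋃ m, ⋃ _ : Even m,
      ({ρ : ℕ → Q | ∀ i, ∃ j ≥ i, f (ρ j) = m} ∩
        ⋂ n, ⋂ _ : m < n, {ρ : ℕ → Q | ∀ i, ∃ j ≥ i, f (ρ j) = n}ᶜ) := by
    ext ρ
    simp only [MultiEnv.parityObjective, IsGreatest, upperBounds, Set.mem_ofPred_eq, Set.mem_iUnion,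
      Set.mem_inter_iff, Set.mem_iInter, Set.mem_compl_iff, exists_prop]
    refine exists_congr fun m => ?_
    rw [and_comm]
    refine and_congr_right fun _ => and_congr_right fun _ => ?_
    exact forall_congr' fun n => ⟨fun h hlt h' => absurd (h h') (not_le.2 hlt),
      fun h h' => not_lt.1 fun hlt => h hlt h'⟩
  rw [this]
  exact .iUnion fun m => .iUnion fun _ => (hS m).inter <|
    .iInter fun n => .iInter fun _ => (hS n).compl

/-- The sets `Q`, `A`, `E` of states, actions and environments are finite and non-empty. On the
finite set `Q` the `σ`-algebra is discrete, so `MeasurableSet W` says that `W` is a Borel subset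
of the space of infinite paths. -/
theorem mainTheorem3 {Q A E : Type*} [Fintype Q] [Nonempty Q] [Fintype A] [Nonempty A]
    [Fintype E] [Nonempty E] [MeasurableSpace Q] [DiscreteMeasurableSpace Q]
    [MeasurableSpace A] [DiscreteMeasurableSpace A] (Γ : MultiEnv.MEMDP Q A E) (q : Q) :
    (∀ W : Set (ℕ → Q), MeasurableSet W →
      Γ.uniValue q W = ⨅ b : PMF E, Γ.priorValue q b W) ∧
    (∀ f : Q → ℕ, Γ.uniValue q (MultiEnv.parityObjective f) =
      ⨅ b : PMF E, Γ.priorValue q b (MultiEnv.parityObjective f)) := by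
  have main : ∀ W : Set (ℕ → Q), MeasurableSet W →
      Γ.uniValue q W = ⨅ b : PMF E, Γ.priorValue q b W := by
    intro W _
    have : Nonempty (MultiEnv.Strategy Q A) := ⟨fun _ => PMF.pure (Classical.arbitrary A)⟩
    refine iSup_iInf_eq_iInf_iSup_of_convex
      (fun (σ : MultiEnv.Strategy Q A) e => (Γ.env e).pathMeasure σ q W)
      (fun σ e => prob_le_one) fun σ τ a b hab => ⟨mixStrategy σ τ a b hab, fun e => ?_⟩
    simp [pathMeasure_mixStrategy]
  exact ⟨main, fun f => main _ (measurableSet_parityObjective f)⟩
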